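/- Let $\mathbb{R}^{1+2}$ denote $\mathbb{R}^3$ with coordinates $(x^0,x^1,x^2)$ and the Minkowski metric $\eta=-(dx^0)^2+(dx^1)^2+(dx^2)^2$. Let $\phi\colon\mathbb{R}^2\to\mathbb{R}^{1+2}$ be a smooth, proper immersion which is timelike, i.e. the induced metric $g_{ij}=\eta(\partial_i\phi,\partial_j\phi)$ satisfies $\det g<0$ at every point, and which has vanishing mean curvature, i.e. $H=g^{ij}(\partial_i\partial_j\phi)^{\perp}=0$, where $\perp$ denotes the component $\eta$-orthogonal to the tangent plane of $\phi$. Then $\phi$ is a (smooth) embedding. Moreover, for each compact subset $K\subseteq\phi(\mathbb{R}^2)$ there is a timelike plane $P\subseteq\mathbb{R}^{1+2}$ (a two-dimensional linear subspace containing a vector $v$ with $\eta(v,v)<0$) such that $K$ is a smooth graph over $P$: there are a set $D\subseteq P$ and a smooth function $f$, defined on an open neighbourhood of $D$ in $P$ and taking values in the $\eta$-orthogonal complement $P^{\perp}$, such that $K=\{p+f(p):p\in D\}$. -/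

import Mathlib

open scoped ContDiff

noncomputable section

/-- The parameter plane `ℝ²`. Only its topology and smooth structure are used. -/
abbrev Plane : Type := Fin 2 → ℝ

/-- The vector space `ℝ^{1+2}` with inertial coordinates `(x 0, x 1, x 2)`, where `x 0` is time.
Its geometry is given by `minkowski`. -/
abbrev MinkowskiSpace : Type := Fin 3 → ℝ

/-- The Minkowski metric `η = -(dx⁰)² + (dx¹)² + (dx²)²`. -/
def minkowski (v w : MinkowskiSpace) : ℝ :=
  -(v 0 * w 0) + v 1 * w 1 + v 2 * w 2

/-- `φ` is a smooth immersion: it is smooth with injective differential at every point. -/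
def IsSmoothImmersion (φ : Plane → MinkowskiSpace) : Prop :=
  ContDiff ℝ ∞ φ ∧ ∀ p, Function.Injective (fderiv ℝ φ p)

/-- `φ` is a smooth embedding: a smooth immersion which is a homeomorphism onto its image. -/
def IsSmoothEmbedding (φ : Plane → MinkowskiSpace) : Prop :=
  IsSmoothImmersion φ ∧ Topology.IsEmbedding φ

/-- The partial derivative `∂ᵢ φ`. -/
def partialDeriv (i : Fin 2) (φ : Plane → MinkowskiSpace) (p : Plane) : MinkowskiSpace :=
  fderiv ℝ φ p (Pi.single i 1)

/-- The matrix `g i j = η (∂ᵢ φ) (∂ⱼ φ)` of the metric induced by `φ`. -/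
def inducedMetric (φ : Plane → MinkowskiSpace) (p : Plane) : Matrix (Fin 2) (Fin 2) ℝ :=
  Matrix.of fun i j => minkowski (partialDeriv i φ p) (partialDeriv j φ p)

/-- `φ` is timelike if its induced metric has negative determinant at every point. -/
def IsTimelike (φ : Plane → MinkowskiSpace) : Prop :=
  ∀ p, (inducedMetric φ p).det < 0

/-- The component of `v` which is `η`-orthogonal to the tangent plane of `φ` at `p`:
`v - gᵏˡ η(v, ∂ₖ φ) ∂ₗ φ`. -/
def normalPart (φ : Plane → MinkowskiSpace) (p : Plane) (v : MinkowskiSpace) : MinkowskiSpace :=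
  v - ∑ k, ∑ l, ((inducedMetric φ p)⁻¹ k l * minkowski v (partialDeriv k φ p)) •
    partialDeriv l φ p

/-- The second fundamental form `II i j`, the normal part of `∂ᵢ ∂ⱼ φ`. -/
def secondFundamentalForm (φ : Plane → MinkowskiSpace) (p : Plane) (i j : Fin 2) :
    MinkowskiSpace :=
  normalPart φ p (partialDeriv i (partialDeriv j φ) p)

/-- The mean curvature vector `H = gⁱʲ II i j`. -/
def meanCurvature (φ : Plane → MinkowskiSpace) (p : Plane) : MinkowskiSpace :=
  ∑ i, ∑ j, (inducedMetric φ p)⁻¹ i j • secondFundamentalForm φ p i j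

/-- A timelike plane (through the origin): a two-dimensional subspace containing a timelike
vector; equivalently, `η` restricts to it as a form of signature `(-,+)`. -/
def IsTimelikePlane (P : Submodule ℝ MinkowskiSpace) : Prop :=
  Module.finrank ℝ P = 2 ∧ ∃ v ∈ P, minkowski v v < 0

/-- `K` is a smooth graph over the plane `P`: it is `{p + f p : p ∈ D}`, where `D ⊆ P` and `f` is
a smooth function, on an open set of `P` containing `D`, with values in the `η`-orthogonal
complement of `P` (which is a line if `P` is a timelike plane). -/
def IsSmoothGraphOver (P : Submodule ℝ MinkowskiSpace) (K : Set MinkowskiSpace) : Prop :=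
  ∃ (D U : Set P) (f : P → MinkowskiSpace),
    IsOpen U ∧ D ⊆ U ∧ ContDiffOn ℝ ∞ f U ∧
    (∀ p ∈ U, ∀ q : P, minkowski (f p) q = 0) ∧
    K = (fun p : P => (p : MinkowskiSpace) + f p) '' D

end

/-! A timelike surface has two null directions; let `L`, `N` be null fields whose images `l`, `m`
under `dφ` have time component 1. Vanishing mean curvature says that D²φ(L, N) is tangent. Since `l`
is null with fixed time component, this forces `l` to be constant along `N`, and likewise `m` along
`L` (`fderiv_l_N`). Hence `L` and `N` commute (`fderiv_L_N_eq`) and are the coordinate fields of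
null coordinates `u`, `v` with u + v = x⁰ (`exists_isFrameCoords`). Properness makes their flows
complete, so (u, v) is a bijection onto ℝ² (`IsFrameCoords.bijective`).

Now `l` depends on `u` alone and `m` on `v` alone. Every pair (s, r) is attained and `l ≠ m`
pointwise, so the two curves on the circle of null directions are disjoint. Compact pieces of them
are separated by a line c + a x¹ + b x² = 0 (`exists_separating_functional`). The functional Λ = c
x⁰ + a x¹ + b x² then increases along `L` and decreases along `N`, so Λ and x⁰ = u + v together
separate points of a square |u|, |v| < R (`eq_of_add_eq`).

So on each square the projection of φ to the plane spanned by the time axis and (a, b) is an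
injective immersion, which gives the graph. As R is arbitrary, φ is injective, and a proper
injective map is a closed embedding. -/

/-! ### Null vectors in a timelike plane -/

/-- The Euclidean normal `p × q` of the plane spanned by `p` and `q`. -/
def euclideanNormal (p q : MinkowskiSpace) : MinkowskiSpace :=
  ![p 1 * q 2 - p 2 * q 1, p 2 * q 0 - p 0 * q 2, p 0 * q 1 - p 1 * q 0]

/-- `n₁² + n₂² - n₀²`, which is positive iff the plane with Euclidean normal `n` is timelike. -/
def normalDiscr (n : MinkowskiSpace) : ℝ := n 1 ^ 2 + n 2 ^ 2 - n 0 ^ 2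

/-- For `ε = ±1`, the two null vectors with time component `1` of the plane with Euclidean
normal `n`. -/
noncomputable def nullVec (ε : ℝ) (n : MinkowskiSpace) : MinkowskiSpace :=
  ![1, (-(n 0 * n 1) - ε * √(normalDiscr n) * n 2) / (n 1 ^ 2 + n 2 ^ 2),
    (-(n 0 * n 2) + ε * √(normalDiscr n) * n 1) / (n 1 ^ 2 + n 2 ^ 2)]

/-- The coordinates of `v` with respect to the basis `p, q` of a plane containing `v`. -/
noncomputable def tangentCoords (p q v : MinkowskiSpace) : Plane :=
  ![euclideanNormal v q ⬝ᵥ euclideanNormal p q / euclideanNormal p q ⬝ᵥ euclideanNormal p q,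
    euclideanNormal p v ⬝ᵥ euclideanNormal p q / euclideanNormal p q ⬝ᵥ euclideanNormal p q]

theorem minkowski_add_left (v v' w : MinkowskiSpace) :
    minkowski (v + v') w = minkowski v w + minkowski v' w := by
  simp [minkowski]; ring

theorem minkowski_smul_left (c : ℝ) (v w : MinkowskiSpace) :
    minkowski (c • v) w = c * minkowski v w := by
  simp [minkowski]; ring

theorem minkowski_comm (v w : MinkowskiSpace) : minkowski v w = minkowski w v := by
  simp [minkowski]; ring

theorem gram_det_eq (p q : MinkowskiSpace) :
    minkowski p p * minkowski q q - minkowski p q * minkowski q p =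
      -normalDiscr (euclideanNormal p q) := by
  simp [minkowski, normalDiscr, euclideanNormal]; ring

theorem spatial_pos {n : MinkowskiSpace} (hn : 0 < normalDiscr n) : 0 < n 1 ^ 2 + n 2 ^ 2 := by
  unfold normalDiscr at hn; nlinarith [sq_nonneg (n 0)]

theorem minkowski_nullVec_self {ε : ℝ} (hε : ε ^ 2 = 1) {n : MinkowskiSpace}
    (hn : 0 < normalDiscr n) : minkowski (nullVec ε n) (nullVec ε n) = 0 := by
  have hS := spatial_pos hn
  have hD := Real.sq_sqrt hn.le
  simp only [minkowski, nullVec, Matrix.cons_val]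
  field_simp
  set D := √(normalDiscr n)
  unfold normalDiscr at hD
  linear_combination (n 1 ^ 2 + n 2 ^ 2) * (hD + D ^ 2 * hε)

theorem dotProduct_nullVec (ε : ℝ) {n : MinkowskiSpace} (hn : 0 < normalDiscr n) :
    n ⬝ᵥ nullVec ε n = 0 := by
  have hS := spatial_pos hn
  simp only [dotProduct, Fin.sum_univ_three, nullVec, Matrix.cons_val]
  field_simp
  ring

theorem nullVec_ne {n : MinkowskiSpace} (hn : 0 < normalDiscr n) :
    nullVec 1 n ≠ nullVec (-1) n := by
  intro h
  have hS := spatial_pos hn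
  have hD := Real.sqrt_pos.2 hn
  have h1 := congrFun h 1
  have h2 := congrFun h 2
  simp only [nullVec, Matrix.cons_val] at h1 h2
  field_simp at h1 h2
  have e1 : n 2 = 0 := by
    have : √(normalDiscr n) * n 2 = 0 := by linarith
    simpa [hD.ne'] using this
  have e2 : n 1 = 0 := by
    have : √(normalDiscr n) * n 1 = 0 := by linarith
    simpa [hD.ne'] using this
  simp [e1, e2] at hS

theorem dotProduct_self_pos {n : MinkowskiSpace} (hn : 0 < normalDiscr n) : 0 < n ⬝ᵥ n := by
  have hS := spatial_pos hn
  simp only [dotProduct, Fin.sum_univ_three]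
  nlinarith [sq_nonneg (n 0)]

/-- Cramer's rule: if v = α p + β q, then v × q = α (p × q) and p × v = β (p × q). -/
theorem tangentCoords_spec {p q v : MinkowskiSpace} (hn : 0 < normalDiscr (euclideanNormal p q))
    (hv : euclideanNormal p q ⬝ᵥ v = 0) :
    tangentCoords p q v 0 • p + tangentCoords p q v 1 • q = v := by
  have h := (dotProduct_self_pos hn).ne'
  simp only [dotProduct, Fin.sum_univ_three, euclideanNormal, Matrix.cons_val] at h hv
  ext i
  simp only [tangentCoords, dotProduct, Fin.sum_univ_three, euclideanNormal, Matrix.cons_val,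
    Pi.add_apply, Pi.smul_apply, smul_eq_mul]
  rw [div_mul_eq_mul_div, div_mul_eq_mul_div, ← add_div, div_eq_iff h]
  fin_cases i <;> simp only [Fin.zero_eta, Fin.mk_one, Fin.reduceFinMk]
  · linear_combination (-(p 1 * q 2 - p 2 * q 1)) * hv
  · linear_combination (-(p 2 * q 0 - p 0 * q 2)) * hv
  · linear_combination (-(p 0 * q 1 - p 1 * q 0)) * hv

/-! ### Smooth dependence of the null vectors on the plane -/

section Smoothness

variable {E : Type*} [NormedAddCommGroup E] [NormedSpace ℝ E]

theorem ContDiff.minkowski {f g : E → MinkowskiSpace} {k : WithTop ℕ∞} (hf : ContDiff ℝ k f)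
    (hg : ContDiff ℝ k g) : ContDiff ℝ k fun x => minkowski (f x) (g x) := by
  unfold _root_.minkowski; fun_prop

theorem ContDiff.euclideanNormal {f g : E → MinkowskiSpace} {k : WithTop ℕ∞}
    (hf : ContDiff ℝ k f) (hg : ContDiff ℝ k g) :
    ContDiff ℝ k fun x => euclideanNormal (f x) (g x) := by
  rw [contDiff_pi]
  intro i
  fin_cases i <;> simp only [_root_.euclideanNormal, Fin.zero_eta, Fin.mk_one, Fin.reduceFinMk,
    Matrix.cons_val] <;> fun_prop

theorem ContDiff.normalDiscr {f : E → MinkowskiSpace} {k : WithTop ℕ∞} (hf : ContDiff ℝ k f) :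
    ContDiff ℝ k fun x => normalDiscr (f x) := by
  unfold _root_.normalDiscr; fun_prop

theorem ContDiff.nullVec {f : E → MinkowskiSpace} {k : WithTop ℕ∞} (hf : ContDiff ℝ k f)
    (hpos : ∀ x, 0 < _root_.normalDiscr (f x)) (ε : ℝ) :
    ContDiff ℝ k fun x => nullVec ε (f x) := by
  have hD : ContDiff ℝ k fun x => √(_root_.normalDiscr (f x)) :=
    hf.normalDiscr.sqrt fun x => (hpos x).ne'
  have hS : ∀ x, f x 1 ^ 2 + f x 2 ^ 2 ≠ 0 := fun x => (spatial_pos (hpos x)).ne'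
  rw [contDiff_pi]
  intro i
  fin_cases i <;> simp only [_root_.nullVec, Fin.zero_eta, Fin.mk_one, Fin.reduceFinMk,
    Matrix.cons_val]
  · exact contDiff_const
  · exact ContDiff.div (by fun_prop) (by fun_prop) hS
  · exact ContDiff.div (by fun_prop) (by fun_prop) hS

theorem ContDiff.tangentCoords {f g h : E → MinkowskiSpace} {k : WithTop ℕ∞}
    (hf : ContDiff ℝ k f) (hg : ContDiff ℝ k g) (hh : ContDiff ℝ k h)
    (hpos : ∀ x, 0 < _root_.normalDiscr (_root_.euclideanNormal (f x) (g x))) :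
    ContDiff ℝ k fun x => tangentCoords (f x) (g x) (h x) := by
  have h1 := hf.euclideanNormal hg
  have h2 := hh.euclideanNormal hg
  have h3 := hf.euclideanNormal hh
  have h0 := fun x => (dotProduct_self_pos (hpos x)).ne'
  rw [contDiff_pi]
  intro i
  fin_cases i <;> simp only [_root_.tangentCoords, Fin.zero_eta, Fin.mk_one, Matrix.cons_val]
  · refine ContDiff.div ?_ ?_ h0 <;> simp only [dotProduct, Fin.sum_univ_three] <;> fun_prop
  · refine ContDiff.div ?_ ?_ h0 <;> simp only [dotProduct, Fin.sum_univ_three] <;> fun_prop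

end Smoothness

/-! ### The null frame of a timelike surface -/

theorem fderiv_apply_eq_partialDeriv (φ : Plane → MinkowskiSpace) (p X : Plane) :
    fderiv ℝ φ p X = X 0 • partialDeriv 0 φ p + X 1 • partialDeriv 1 φ p := by
  have : X = X 0 • (Pi.single 0 1 : Plane) + X 1 • (Pi.single 1 1 : Plane) := by
    ext i; fin_cases i <;> simp
  conv_lhs => rw [this]
  simp [partialDeriv]

theorem contDiff_partialDeriv {φ : Plane → MinkowskiSpace} (hφ : ContDiff ℝ ∞ φ) (i : Fin 2) :
    ContDiff ℝ ∞ (partialDeriv i φ) :=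
  (hφ.fderiv_right (m := ∞) (by simp)).clm_apply contDiff_const

theorem normalDiscr_pos_of_isTimelike {φ : Plane → MinkowskiSpace} (h : IsTimelike φ) (p : Plane) :
    0 < normalDiscr (euclideanNormal (partialDeriv 0 φ p) (partialDeriv 1 φ p)) := by
  have := h p
  rw [Matrix.det_fin_two] at this
  simp only [inducedMetric, Matrix.of_apply, gram_det_eq] at this
  linarith

/-- A smooth frame `L, N` of null vector fields, with images `l = dφ L`, `m = dφ N`, both
normalised to have time component `1`. -/
structure IsNullFrame (φ : Plane → MinkowskiSpace) (L N : Plane → Plane)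
    (l m : Plane → MinkowskiSpace) : Prop where
  contDiff_L : ContDiff ℝ ∞ L
  contDiff_N : ContDiff ℝ ∞ N
  contDiff_l : ContDiff ℝ ∞ l
  contDiff_m : ContDiff ℝ ∞ m
  fderiv_L : ∀ p, fderiv ℝ φ p (L p) = l p
  fderiv_N : ∀ p, fderiv ℝ φ p (N p) = m p
  l_zero : ∀ p, l p 0 = 1
  m_zero : ∀ p, m p 0 = 1
  null_l : ∀ p, minkowski (l p) (l p) = 0
  null_m : ∀ p, minkowski (m p) (m p) = 0
  l_ne_m : ∀ p, l p ≠ m p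

theorem exists_isNullFrame {φ : Plane → MinkowskiSpace} (hφ : ContDiff ℝ ∞ φ)
    (ht : IsTimelike φ) : ∃ L N l m, IsNullFrame φ L N l m := by
  have hpos := normalDiscr_pos_of_isTimelike ht
  have h0 := contDiff_partialDeriv hφ 0
  have h1 := contDiff_partialDeriv hφ 1
  have hn := h0.euclideanNormal h1
  have hl := hn.nullVec hpos 1
  have hm := hn.nullVec hpos (-1)
  have key : ∀ ε p, fderiv ℝ φ p (tangentCoords (partialDeriv 0 φ p) (partialDeriv 1 φ p)
      (nullVec ε (euclideanNormal (partialDeriv 0 φ p) (partialDeriv 1 φ p)))) =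
      nullVec ε (euclideanNormal (partialDeriv 0 φ p) (partialDeriv 1 φ p)) := fun ε p => by
    rw [fderiv_apply_eq_partialDeriv]
    exact tangentCoords_spec (hpos p) (dotProduct_nullVec ε (hpos p))
  exact ⟨_, _, _, _, h0.tangentCoords h1 hl hpos, h0.tangentCoords h1 hm hpos, hl, hm, key 1,
    key (-1), fun p => rfl, fun p => rfl, fun p => minkowski_nullVec_self (by norm_num) (hpos p),
    fun p => minkowski_nullVec_self (by norm_num) (hpos p), fun p => nullVec_ne (hpos p)⟩

theorem minkowski_null_eq {v w : MinkowskiSpace} (hv : v 0 = 1) (hw : w 0 = 1)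
    (hvv : minkowski v v = 0) (hww : minkowski w w = 0) :
    minkowski v w = -((v 1 - w 1) ^ 2 + (v 2 - w 2) ^ 2) / 2 := by
  simp only [minkowski, hv, hw] at *
  linear_combination (-hvv - hww) / (-2)

theorem minkowski_null_neg {v w : MinkowskiSpace} (hv : v 0 = 1) (hw : w 0 = 1)
    (hvv : minkowski v v = 0) (hww : minkowski w w = 0) (hne : v ≠ w) : minkowski v w < 0 := by
  rw [minkowski_null_eq hv hw hvv hww]
  by_contra! h
  apply hne
  have h1 : v 1 - w 1 = 0 := by nlinarith [sq_nonneg (v 1 - w 1), sq_nonneg (v 2 - w 2)]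
  have h2 : v 2 - w 2 = 0 := by nlinarith [sq_nonneg (v 1 - w 1), sq_nonneg (v 2 - w 2)]
  ext i; fin_cases i
  · simp [hv, hw]
  · simpa using sub_eq_zero.1 h1
  · simpa using sub_eq_zero.1 h2

/-! ### Mean curvature and the Hessian -/

theorem Matrix.inv_fin_two_apply {A : Matrix (Fin 2) (Fin 2) ℝ} :
    A⁻¹ = A.det⁻¹ • !![A 1 1, -A 0 1; -A 1 0, A 0 0] := by
  rw [Matrix.inv_def, Matrix.adjugate_fin_two, Ring.inverse_eq_inv']

/-- Only the tangency of the correction term matters later, so its coefficients are hidden. -/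
theorem exists_normalPart_eq (φ : Plane → MinkowskiSpace) (p : Plane) (v : MinkowskiSpace) :
    ∃ X, normalPart φ p v = v - fderiv ℝ φ p X := by
  refine ⟨fun l => ∑ k, (inducedMetric φ p)⁻¹ k l * minkowski v (partialDeriv k φ p), ?_⟩
  rw [fderiv_apply_eq_partialDeriv, normalPart]
  simp only [Fin.sum_univ_two, add_smul]
  abel_nf

/-- The trace of the Hessian with respect to the induced metric is tangent. -/
theorem exists_trace_hessian_eq {φ : Plane → MinkowskiSpace} {p : Plane}
    (hdet : (inducedMetric φ p).det ≠ 0) (hH : meanCurvature φ p = 0) :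
    ∃ X, inducedMetric φ p 1 1 • partialDeriv 0 (partialDeriv 0 φ) p
      - inducedMetric φ p 0 1 • partialDeriv 0 (partialDeriv 1 φ) p
      - inducedMetric φ p 1 0 • partialDeriv 1 (partialDeriv 0 φ) p
      + inducedMetric φ p 0 0 • partialDeriv 1 (partialDeriv 1 φ) p = fderiv ℝ φ p X := by
  choose X hX using exists_normalPart_eq φ p
  set A := inducedMetric φ p
  -- Multiplying by the determinant replaces the inverse metric by the adjugate.
  have h : A.det • meanCurvature φ p = 0 := by rw [hH, smul_zero]
  have h' : ∀ c : ℝ, A.det * (A.det⁻¹ * c) = c := fun c => by field_simp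
  simp only [meanCurvature, secondFundamentalForm, hX, Fin.sum_univ_two] at h
  rw [show inducedMetric φ p = A from rfl, Matrix.inv_fin_two_apply] at h
  simp only [Matrix.smul_apply, Matrix.of_apply, Matrix.cons_val, smul_eq_mul, smul_add,
    smul_smul, h'] at h
  let Y (i j : Fin 2) := X (partialDeriv i (partialDeriv j φ) p)
  refine ⟨A 1 1 • Y 0 0 - A 0 1 • Y 0 1 - A 1 0 • Y 1 0 + A 0 0 • Y 1 1, ?_⟩
  simp only [map_add, map_sub, map_smul]
  rw [← sub_eq_zero, ← h]
  module

theorem partialDeriv_partialDeriv {φ : Plane → MinkowskiSpace} (hφ : ContDiff ℝ ∞ φ)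
    (i j : Fin 2) (p : Plane) :
    partialDeriv i (partialDeriv j φ) p =
      fderiv ℝ (fderiv ℝ φ) p (Pi.single i 1) (Pi.single j 1) := by
  have hd : DifferentiableAt ℝ (fderiv ℝ φ) p :=
    (hφ.fderiv_right (m := ∞) (by simp)).differentiable (by simp) p
  have h : HasFDerivAt (partialDeriv j φ) _ p :=
    hd.hasFDerivAt.clm_apply (hasFDerivAt_const (Pi.single j 1 : Plane) p)
  rw [partialDeriv, h.fderiv]
  simp

theorem fderiv_fderiv_apply_eq {φ : Plane → MinkowskiSpace} (hφ : ContDiff ℝ ∞ φ)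
    (p X Y : Plane) :
    fderiv ℝ (fderiv ℝ φ) p X Y =
      (X 0 * Y 0) • partialDeriv 0 (partialDeriv 0 φ) p
      + (X 0 * Y 1) • partialDeriv 0 (partialDeriv 1 φ) p
      + (X 1 * Y 0) • partialDeriv 1 (partialDeriv 0 φ) p
      + (X 1 * Y 1) • partialDeriv 1 (partialDeriv 1 φ) p := by
  have (X : Plane) : X = X 0 • (Pi.single 0 1 : Plane) + X 1 • (Pi.single 1 1 : Plane) := by
    ext i; fin_cases i <;> simp
  conv_lhs => rw [this X, this Y]
  simp only [partialDeriv_partialDeriv hφ, map_add, map_smul, add_apply,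
    smul_apply, smul_add, smul_smul]
  module

theorem fderiv_fderiv_comm {E F : Type*} [NormedAddCommGroup E] [NormedSpace ℝ E]
    [NormedAddCommGroup F] [NormedSpace ℝ F] {f : E → F} (hf : ContDiff ℝ ∞ f) (p X Y : E) :
    fderiv ℝ (fderiv ℝ f) p X Y = fderiv ℝ (fderiv ℝ f) p Y X :=
  (hf.contDiffAt.isSymmSndFDerivAt (by simp; exact WithTop.coe_le_coe.2 le_top)).eq X Y

theorem fderiv_clm_apply_field {E F : Type*} [NormedAddCommGroup E] [NormedSpace ℝ E]
    [NormedAddCommGroup F] [NormedSpace ℝ F] {f : E → F} (hf : ContDiff ℝ ∞ f) {X : E → E}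
    (hX : ContDiff ℝ ∞ X) (p Y : E) :
    fderiv ℝ (fun x => fderiv ℝ f x (X x)) p Y =
      fderiv ℝ (fderiv ℝ f) p Y (X p) + fderiv ℝ f p (fderiv ℝ X p Y) := by
  have hd : DifferentiableAt ℝ (fderiv ℝ f) p :=
    (hf.fderiv_right (m := ∞) (by simp)).differentiable (by simp) p
  rw [(hd.hasFDerivAt.clm_apply (hX.differentiable (by simp) p).hasFDerivAt).fderiv]
  simp [add_comm]

/-! ### Rigidity of the null directions, and null coordinates -/

namespace IsNullFrame

variable {φ : Plane → MinkowskiSpace} {L N : Plane → Plane} {l m : Plane → MinkowskiSpace}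

theorem symm (h : IsNullFrame φ L N l m) : IsNullFrame φ N L m l :=
  ⟨h.contDiff_N, h.contDiff_L, h.contDiff_m, h.contDiff_l, h.fderiv_N, h.fderiv_L, h.m_zero,
    h.l_zero, h.null_m, h.null_l, fun p => (h.l_ne_m p).symm⟩

theorem minkowski_neg (h : IsNullFrame φ L N l m) (p : Plane) : minkowski (l p) (m p) < 0 :=
  minkowski_null_neg (h.l_zero p) (h.m_zero p) (h.null_l p) (h.null_m p) (h.l_ne_m p)

/-- If `L` and `N` were dependent, so would be `l` and `m`, and their common time component 1 would
force `l = m`. -/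
theorem det_ne_zero (h : IsNullFrame φ L N l m) (p : Plane) :
    L p 0 * N p 1 - L p 1 * N p 0 ≠ 0 := by
  intro h0
  have hl := h.fderiv_L p
  have hm := h.fderiv_N p
  rw [fderiv_apply_eq_partialDeriv] at hl hm
  have e1 : N p 1 • l p = L p 1 • m p := by
    rw [← hl, ← hm]
    ext i
    simp only [Pi.smul_apply, Pi.add_apply, smul_eq_mul]
    linear_combination (partialDeriv 0 φ p i) * h0
  have e2 : N p 0 • l p = L p 0 • m p := by
    rw [← hl, ← hm]
    ext i
    simp only [Pi.smul_apply, Pi.add_apply, smul_eq_mul]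
    linear_combination (-partialDeriv 1 φ p i) * h0
  have f1 := congrFun e1 0
  have f2 := congrFun e2 0
  simp only [Pi.smul_apply, smul_eq_mul, h.l_zero, h.m_zero, mul_one] at f1 f2
  rw [f1] at e1
  rw [f2] at e2
  have g1 : L p 1 = 0 := by
    by_contra hc
    exact h.l_ne_m p (smul_right_injective _ hc e1)
  have g2 : L p 0 = 0 := by
    by_contra hc
    exact h.l_ne_m p (smul_right_injective _ hc e2)
  have : l p = 0 := by rw [← hl, g1, g2]; simp
  simpa [this] using h.l_zero p

theorem exists_coords (h : IsNullFrame φ L N l m) (p X : Plane) :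
    ∃ a b : ℝ, X = a • L p + b • N p := by
  have hd := h.det_ne_zero p
  refine ⟨(X 0 * N p 1 - X 1 * N p 0) / (L p 0 * N p 1 - L p 1 * N p 0),
    (L p 0 * X 1 - L p 1 * X 0) / (L p 0 * N p 1 - L p 1 * N p 0), ?_⟩
  ext i
  fin_cases i <;>
    simp only [Pi.add_apply, Pi.smul_apply, smul_eq_mul, Fin.zero_eta, Fin.mk_one] <;>
    rw [div_mul_eq_mul_div, div_mul_eq_mul_div, ← add_div, eq_div_iff hd] <;> ring

/-- Vanishing mean curvature means that `D²φ(L, N)` is tangent. -/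
theorem exists_hessian_eq (h : IsNullFrame φ L N l m) (hφ : ContDiff ℝ ∞ φ) {p : Plane}
    (hdet : (inducedMetric φ p).det ≠ 0) (hH : meanCurvature φ p = 0) :
    ∃ X, fderiv ℝ (fderiv ℝ φ) p (N p) (L p) = fderiv ℝ φ p X := by
  obtain ⟨X, hX⟩ := exists_trace_hessian_eq hdet hH
  have hd := h.det_ne_zero p
  have hk := (h.minkowski_neg p).ne
  have hl := h.fderiv_L p
  have hm := h.fderiv_N p
  rw [fderiv_apply_eq_partialDeriv] at hl hm
  have hsym : partialDeriv 1 (partialDeriv 0 φ) p = partialDeriv 0 (partialDeriv 1 φ) p := by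
    rw [partialDeriv_partialDeriv hφ, partialDeriv_partialDeriv hφ, fderiv_fderiv_comm hφ]
  set δ := L p 0 * N p 1 - L p 1 * N p 0 with hδ
  have e0 : partialDeriv 0 φ p = (N p 1 / δ) • l p - (L p 1 / δ) • m p := by
    rw [← hl, ← hm]
    ext i
    simp only [Pi.smul_apply, Pi.add_apply, Pi.sub_apply, smul_eq_mul]
    field_simp
    rw [hδ]; ring
  have e1 : partialDeriv 1 φ p = (L p 0 / δ) • m p - (N p 0 / δ) • l p := by
    rw [← hl, ← hm]
    ext i
    simp only [Pi.smul_apply, Pi.add_apply, Pi.sub_apply, smul_eq_mul]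
    field_simp
    rw [hδ]; ring
  have key (a b c d : ℝ) : minkowski (a • l p + b • m p) (c • l p + d • m p) =
      (a * d + b * c) * minkowski (l p) (m p) := by
    have h1 := h.null_l p
    have h2 := h.null_m p
    simp only [minkowski, Pi.add_apply, Pi.smul_apply, smul_eq_mul] at h1 h2 ⊢
    linear_combination a * c * h1 + b * d * h2
  have g00 : inducedMetric φ p 0 0 = -2 * N p 1 * L p 1 / δ ^ 2 * minkowski (l p) (m p) := by
    rw [inducedMetric, Matrix.of_apply, e0, sub_eq_add_neg, ← neg_smul, key]
    field_simp; ring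
  have g11 : inducedMetric φ p 1 1 = -2 * N p 0 * L p 0 / δ ^ 2 * minkowski (l p) (m p) := by
    rw [inducedMetric, Matrix.of_apply, e1, sub_eq_neg_add, ← neg_smul, key]
    field_simp; ring
  have g01 : inducedMetric φ p 0 1 =
      (N p 1 * L p 0 + N p 0 * L p 1) / δ ^ 2 * minkowski (l p) (m p) := by
    rw [inducedMetric, Matrix.of_apply, e0, e1, sub_eq_neg_add ((L p 0 / δ) • m p),
      sub_eq_add_neg, ← neg_smul, ← neg_smul, key]
    field_simp
  have g10 : inducedMetric φ p 1 0 = inducedMetric φ p 0 1 := by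
    simp only [inducedMetric, Matrix.of_apply, minkowski_comm]
  -- With κ = η(l, m): the metric trace of the Hessian is (2/κ) D²φ(L, N) and det g = -κ²/δ², so the
  -- adjugate trace is -(2κ/δ²) D²φ(L, N).
  refine ⟨(-δ ^ 2 / (2 * minkowski (l p) (m p))) • X, ?_⟩
  rw [map_smul, ← hX, fderiv_fderiv_apply_eq hφ, g10, g00, g01, g11, hsym]
  ext i
  simp only [Pi.smul_apply, Pi.add_apply, Pi.sub_apply, smul_eq_mul]
  field_simp
  ring

theorem fderiv_l_apply (h : IsNullFrame φ L N l m) (hφ : ContDiff ℝ ∞ φ) (p Y : Plane) :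
    fderiv ℝ l p Y =
      fderiv ℝ (fderiv ℝ φ) p Y (L p) + fderiv ℝ φ p (fderiv ℝ L p Y) := by
  rw [← fderiv_clm_apply_field hφ h.contDiff_L]
  congr 2
  exact funext fun x => (h.fderiv_L x).symm

/-- On a surface of vanishing mean curvature, each null direction is constant along the other
null direction. -/
theorem fderiv_l_N (h : IsNullFrame φ L N l m) (hφ : ContDiff ℝ ∞ φ) {p : Plane}
    (hdet : (inducedMetric φ p).det ≠ 0) (hH : meanCurvature φ p = 0) :
    fderiv ℝ l p (N p) = 0 := by
  obtain ⟨X, hX⟩ := h.exists_hessian_eq hφ hdet hH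
  -- The derivative of `l` along `N` is tangent, so it equals a l + b m. It is η-orthogonal to `l`,
  -- which kills b, and has time component 0, which then kills a.
  obtain ⟨a, b, hab⟩ := h.exists_coords p (X + fderiv ℝ L p (N p))
  have e : fderiv ℝ l p (N p) = a • l p + b • m p := by
    rw [h.fderiv_l_apply hφ, hX, ← map_add, hab, map_add, map_smul, map_smul, h.fderiv_L,
      h.fderiv_N]
  have hld : HasFDerivAt l (fderiv ℝ l p) p := (h.contDiff_l.differentiable (by simp) p).hasFDerivAt
  have hi : ∀ i, HasFDerivAt (fun x => l x i) ((ContinuousLinearMap.proj i).comp (fderiv ℝ l p)) p :=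
    fun i => (hasFDerivAt_pi'.1 hld i)
  have h0 : fderiv ℝ l p (N p) 0 = 0 := by
    have : HasFDerivAt (fun x => l x 0) (0 : Plane →L[ℝ] ℝ) p := by
      simp only [h.l_zero]; exact hasFDerivAt_const _ _
    simpa using congrArg (fun T => T (N p)) ((hi 0).unique this)
  have h1 : minkowski (fderiv ℝ l p (N p)) (l p) = 0 := by
    have h2 : HasFDerivAt (fun x => minkowski (l x) (l x)) (0 : Plane →L[ℝ] ℝ) p := by
      simp only [h.null_l]; exact hasFDerivAt_const _ _
    have h3 : HasFDerivAt (fun x => minkowski (l x) (l x)) _ p :=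
      (((hi 0).mul (hi 0)).neg.add ((hi 1).mul (hi 1))).add ((hi 2).mul (hi 2))
    have h4 := congrArg (fun T => T (N p)) (h3.unique h2)
    simp at h4
    simp only [minkowski]
    linarith
  have hb : b = 0 := by
    rw [e, minkowski_add_left, minkowski_smul_left, minkowski_smul_left, h.null_l,
      minkowski_comm (m p)] at h1
    simpa [(h.minkowski_neg p).ne] using h1
  have ha : a = 0 := by
    rw [e, hb] at h0
    simpa [h.l_zero] using h0
  rw [e, ha, hb]; simp

/-- This is [L, N] = 0. Expanding dl(N) = 0 and dm(L) = 0 by the product rule, the Hessian terms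
agree by symmetry, and dφ is injective. -/
theorem fderiv_L_N_eq (h : IsNullFrame φ L N l m) (hφ : IsSmoothImmersion φ) {p : Plane}
    (hdet : (inducedMetric φ p).det ≠ 0) (hH : meanCurvature φ p = 0) :
    fderiv ℝ L p (N p) = fderiv ℝ N p (L p) := by
  have e1 := h.fderiv_l_N hφ.1 hdet hH
  have e2 := h.symm.fderiv_l_N hφ.1 hdet hH
  rw [h.fderiv_l_apply hφ.1] at e1
  rw [h.symm.fderiv_l_apply hφ.1, fderiv_fderiv_comm hφ.1] at e2
  exact hφ.2 p (add_left_cancel (e1.trans e2.symm))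

/-- The function `u` increases at unit rate along `L` and is constant along `N`. -/
theorem exists_null_coordinate (h : IsNullFrame φ L N l m) (hφ : IsSmoothImmersion φ)
    (ht : IsTimelike φ) (hH : ∀ p, meanCurvature φ p = 0) :
    ∃ u : Plane → ℝ, ContDiff ℝ ∞ u ∧ ∀ p, fderiv ℝ u p (L p) = 1 ∧ fderiv ℝ u p (N p) = 0 := by
  have hdφ : ContDiff ℝ ∞ (fderiv ℝ φ) := hφ.1.fderiv_right (by simp)
  let B (w : MinkowskiSpace) : MinkowskiSpace →L[ℝ] ℝ :=
    -(w 0 • ContinuousLinearMap.proj 0) + w 1 • ContinuousLinearMap.proj 1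
      + w 2 • ContinuousLinearMap.proj 2
  have hB : ∀ v w, B w v = minkowski v w := fun v w => by
    simp [B, minkowski]; ring
  -- The dual one-form with σ(L) = 1 and σ(N) = 0: pairing with `m` annihilates the `N` component.
  let σ : Plane → Plane →L[ℝ] ℝ := fun p =>
    (minkowski (l p) (m p))⁻¹ • (B (m p)).comp (fderiv ℝ φ p)
  have hσ : ContDiff ℝ ∞ σ := by
    have h1 : ContDiff ℝ ∞ fun p => (minkowski (l p) (m p))⁻¹ :=
      (h.contDiff_l.minkowski h.contDiff_m).inv fun p => (h.minkowski_neg p).ne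
    have hm := h.contDiff_m
    have h2 : ContDiff ℝ ∞ fun p => B (m p) := by simp only [B]; fun_prop
    exact h1.smul (h2.clm_comp hdφ)
  have σL : ∀ p, σ p (L p) = 1 := fun p => by
    simp [σ, hB, h.fderiv_L, inv_mul_cancel₀ (h.minkowski_neg p).ne]
  have σN : ∀ p, σ p (N p) = 0 := fun p => by
    simp [σ, hB, h.fderiv_N, h.null_m]
  have hd : ∀ p, HasFDerivAt σ (fderiv ℝ σ p) p := fun p =>
    (hσ.differentiable (by simp) p).hasFDerivAt
  have c1 : ∀ p Y, fderiv ℝ σ p Y (L p) = -σ p (fderiv ℝ L p Y) := fun p Y => by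
    have h1 := (hd p).clm_apply (h.contDiff_L.differentiable (by simp) p).hasFDerivAt
    simp only [σL] at h1
    have := congrArg (fun T => T Y) (h1.unique (hasFDerivAt_const (1 : ℝ) p))
    simp at this
    linarith
  have c2 : ∀ p Y, fderiv ℝ σ p Y (N p) = -σ p (fderiv ℝ N p Y) := fun p Y => by
    have h1 := (hd p).clm_apply (h.contDiff_N.differentiable (by simp) p).hasFDerivAt
    simp only [σN] at h1
    have := congrArg (fun T => T Y) (h1.unique (hasFDerivAt_const (0 : ℝ) p))
    simp at this
    linarith
  -- dσ(L, N) = L σ(N) - N σ(L) - σ([L, N]) vanishes, since the first two terms differentiate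
  -- constants and the fields commute.
  have hclosed : ∀ p X Y, fderiv ℝ σ p X Y = fderiv ℝ σ p Y X := by
    intro p X Y
    obtain ⟨a, b, rfl⟩ := h.exists_coords p X
    obtain ⟨c, d, rfl⟩ := h.exists_coords p Y
    have : fderiv ℝ σ p (N p) (L p) = fderiv ℝ σ p (L p) (N p) := by
      rw [c1, c2, h.fderiv_L_N_eq hφ (ht p).ne (hH p)]
    simp [this]
    ring
  obtain ⟨u, hu⟩ := convex_univ.exists_forall_hasFDerivAt_of_fderiv_symmetric isOpen_univ
    (hσ.differentiable (by simp)).differentiableOn fun p _ => hclosed p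
  have hu' : fderiv ℝ u = σ := funext fun p => (hu p trivial).fderiv
  refine ⟨u, ?_, fun p => by rw [hu']; exact ⟨σL p, σN p⟩⟩
  rw [contDiff_infty_iff_fderiv, hu']
  exact ⟨fun p => (hu p trivial).differentiableAt, hσ⟩

end IsNullFrame

/-! ### Completeness of the null flows -/

section Flows

variable {E F : Type*} [NormedAddCommGroup E] [NormedSpace ℝ E] [FiniteDimensional ℝ E]
  [NormedAddCommGroup F] [NormedSpace ℝ F] [FiniteDimensional ℝ F]

/-- If `φ` is proper, a vector field `X` for which `dφ X` is bounded has integral curves on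
arbitrarily long intervals. -/
theorem exists_integralCurve_Ioo {φ : E → F} (hφ : ContDiff ℝ ∞ φ) (hproper : IsProperMap φ)
    {X : E → E} (hX : ContDiff ℝ ∞ X) (hbound : ∀ x, ‖fderiv ℝ φ x (X x)‖ ≤ 1) (p : E) {T : ℝ}
    (hT : 0 < T) :
    ∃ c : ℝ → E, c 0 = p ∧ ∀ t ∈ Set.Ioo (-T) T, HasDerivAt c (X (c t)) t := by
  -- Cutting off in the target keeps the field unchanged where φ is within T of φ(p); properness
  -- makes the support of the result compact, hence the field bounded and Lipschitz.
  let χ : ContDiffBump (φ p) := ⟨T, T + 1, hT, by linarith⟩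
  let Y : E → E := fun x => χ (φ x) • X x
  have hY : ContDiff ℝ ∞ Y := (χ.contDiff.comp hφ).smul hX
  have hYc : HasCompactSupport Y := by
    refine HasCompactSupport.of_support_subset_isCompact
      (hproper.isCompact_preimage (ProperSpace.isCompact_closedBall (φ p) (T + 1))) ?_
    intro x hx
    have h1 : χ (φ x) ≠ 0 := fun h0 => hx (by simp [Y, h0])
    have h2 : φ x ∈ Function.support χ := h1
    rw [χ.support_eq] at h2
    exact Metric.ball_subset_closedBall h2
  obtain ⟨K, hK⟩ := ContDiff.lipschitzWith_of_hasCompactSupport hYc hY (by simp)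
  obtain ⟨C, hC⟩ := hYc.exists_bound_of_continuous hY.continuous
  have hC0 : 0 ≤ C := (norm_nonneg _).trans (hC p)
  have hPL : IsPicardLindelof (fun _ => Y) (tmin := -T) (tmax := T)
      ⟨0, by constructor <;> linarith⟩ p ⟨C * T, by positivity⟩ 0 ⟨C, hC0⟩ K := by
    refine ⟨fun t _ => hK.lipschitzOnWith, fun x _ => continuousOn_const, fun t _ x _ => hC x, ?_⟩
    simp only [sub_zero, zero_sub, neg_neg, max_self, NNReal.coe_zero]
    exact le_rfl
  obtain ⟨c, hc0, hc⟩ := hPL.exists_eq_forall_mem_Icc_hasDerivWithinAt₀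
  have hder : ∀ t ∈ Set.Icc (-T) T, HasDerivWithinAt (φ ∘ c)
      (fderiv ℝ φ (c t) (Y (c t))) (Set.Icc (-T) T) t := fun t ht =>
    ((hφ.differentiable (by simp) (c t)).hasFDerivAt).comp_hasDerivWithinAt t (hc t ht)
  have hle : ∀ t ∈ Set.Icc (-T) T, ‖fderiv ℝ φ (c t) (Y (c t))‖ ≤ 1 := fun t _ => by
    simp only [Y, map_smul, norm_smul]
    rw [Real.norm_of_nonneg χ.nonneg]
    exact mul_le_one₀ χ.le_one (norm_nonneg _) (hbound _)
  -- The image curve has speed at most 1, so up to time T it never leaves the ball where the cutoff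
  -- is 1.
  have hχ : ∀ t ∈ Set.Icc (-T) T, χ (φ (c t)) = 1 := fun t ht => by
    apply χ.one_of_mem_closedBall
    have := (convex_Icc (-T) T).norm_image_sub_le_of_norm_hasDerivWithin_le hder hle
      (⟨by linarith, hT.le⟩ : (0 : ℝ) ∈ Set.Icc (-T) T) ht
    rw [mem_closedBall_iff_norm]
    simp only [Function.comp, hc0, sub_zero, one_mul, Real.norm_eq_abs] at this
    exact this.trans (abs_le.2 ht)
  refine ⟨c, hc0, fun t ht => ?_⟩
  have h := (hc t (Set.Ioo_subset_Icc_self ht)).hasDerivAt (Icc_mem_nhds ht.1 ht.2)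
  simpa [Y, hχ t (Set.Ioo_subset_Icc_self ht)] using h

open scoped Manifold in
theorem exists_integralCurve {φ : E → F} (hφ : ContDiff ℝ ∞ φ) (hproper : IsProperMap φ)
    {X : E → E} (hX : ContDiff ℝ ∞ X) (hbound : ∀ x, ‖fderiv ℝ φ x (X x)‖ ≤ 1) (p : E) :
    ∃ c : ℝ → E, c 0 = p ∧ ∀ t, HasDerivAt c (X (c t)) t := by
  have hX1 : ContDiff ℝ 1 X := hX.of_le (by exact_mod_cast le_top)
  -- Integral curves of a C¹ field on arbitrarily long intervals glue by uniqueness.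
  obtain ⟨c, hc0, hc⟩ := (exists_isMIntegralCurve_iff_exists_isMIntegralCurveOn_Ioo (I := 𝓘(ℝ, E))
    (v := X) (contMDiff_vectorSpace_iff_contDiff.2 hX1) p).2 fun a => by
      obtain ⟨c, hc0, hc⟩ := exists_integralCurve_Ioo hφ hproper hX hbound p
        (lt_max_of_lt_right one_pos : 0 < max a 1)
      refine ⟨c, hc0, fun t ht => ?_⟩
      have := hc t ⟨(neg_le_neg (le_max_left a 1)).trans_lt ht.1, ht.2.trans_le (le_max_left a 1)⟩
      exact (hasMFDerivAt_iff_hasFDerivAt.2 this.hasFDerivAt).hasMFDerivWithinAt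
  refine ⟨c, hc0, fun t => ?_⟩
  have h1 : HasFDerivAt c ((1 : ℝ →L[ℝ] ℝ).smulRight (X (c t))) t :=
    hasMFDerivAt_iff_hasFDerivAt.1 (hc t)
  simpa using h1.hasDerivAt

end Flows

/-! ### Null coordinates are global -/

theorem apply_integralCurve {E : Type*} [NormedAddCommGroup E] [NormedSpace ℝ E] {f : E → ℝ}
    (hf : Differentiable ℝ f) {X : E → E} {k : ℝ} (hk : ∀ p, fderiv ℝ f p (X p) = k) {c : ℝ → E}
    (hc : ∀ t, HasDerivAt c (X (c t)) t) (t : ℝ) : f (c t) = f (c 0) + k * t := by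
  have h : ∀ t, HasDerivAt (fun t => f (c t) - k * t) 0 t := fun t => by
    have h1 := (hf (c t)).hasFDerivAt.comp_hasDerivAt t (hc t)
    rw [hk] at h1
    have h2 := h1.sub ((hasDerivAt_id t).const_mul k)
    rw [mul_one, sub_self] at h2
    exact h2
  have := is_const_of_deriv_eq_zero (fun t => (h t).differentiableAt) (fun t => (h t).deriv) t 0
  simp at this
  linarith

/-- `(u, v)` are coordinates whose coordinate vector fields are `L` and `N`. -/
structure IsFrameCoords (L N : Plane → Plane) (u v : Plane → ℝ) : Prop where
  contDiff_u : ContDiff ℝ ∞ u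
  contDiff_v : ContDiff ℝ ∞ v
  u_L : ∀ p, fderiv ℝ u p (L p) = 1
  u_N : ∀ p, fderiv ℝ u p (N p) = 0
  v_L : ∀ p, fderiv ℝ v p (L p) = 0
  v_N : ∀ p, fderiv ℝ v p (N p) = 1
  exists_curve_L : ∀ p, ∃ c : ℝ → Plane, c 0 = p ∧ ∀ t, HasDerivAt c (L (c t)) t
  exists_curve_N : ∀ p, ∃ c : ℝ → Plane, c 0 = p ∧ ∀ t, HasDerivAt c (N (c t)) t

/-- A smooth map between planes whose differential at `p` is injective restricts to a local
homeomorphism near `p` with smooth inverse. -/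
theorem exists_openPartialHomeomorph {f : Plane → ℝ × ℝ} (hf : ContDiff ℝ ∞ f) {p : Plane}
    (hinj : Function.Injective (fderiv ℝ f p)) :
    ∃ e : OpenPartialHomeomorph Plane (ℝ × ℝ), p ∈ e.source ∧ ⇑e = f ∧
      ContDiffAt ℝ ∞ e.symm (f p) := by
  let A : Plane ≃L[ℝ] ℝ × ℝ := (LinearEquiv.ofInjectiveOfFinrankEq (fderiv ℝ f p : Plane →ₗ[ℝ] ℝ × ℝ)
    hinj (by simp)).toContinuousLinearEquiv
  have hA : HasFDerivAt f (A : Plane →L[ℝ] ℝ × ℝ) p := by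
    have hAf : (A : Plane →L[ℝ] ℝ × ℝ) = fderiv ℝ f p := by ext1; rfl
    rw [hAf]
    exact (hf.differentiable (by simp) p).hasFDerivAt
  exact ⟨hf.contDiffAt.toOpenPartialHomeomorph f hA (by simp),
    hf.contDiffAt.mem_toOpenPartialHomeomorph_source hA (by simp), rfl,
    hf.contDiffAt.to_localInverse hA (by simp)⟩

namespace IsFrameCoords

variable {L N : Plane → Plane} {u v : Plane → ℝ}

theorem symm (h : IsFrameCoords L N u v) : IsFrameCoords N L v u :=
  ⟨h.contDiff_v, h.contDiff_u, h.v_N, h.v_L, h.u_N, h.u_L, h.exists_curve_N, h.exists_curve_L⟩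

/-- The differential of (u, v) sends `L`, `N` to the standard basis. -/
theorem isLocalHomeomorph (h : IsFrameCoords L N u v)
    (hspan : ∀ p X : Plane, ∃ a b : ℝ, X = a • L p + b • N p) :
    IsLocalHomeomorph fun p => (u p, v p) := by
  refine IsLocalHomeomorph.mk _ fun p => ?_
  have hd : HasFDerivAt (fun p => (u p, v p)) ((fderiv ℝ u p).prod (fderiv ℝ v p)) p :=
    (h.contDiff_u.differentiable (by simp) p).hasFDerivAt.prodMk
      (h.contDiff_v.differentiable (by simp) p).hasFDerivAt
  obtain ⟨e, he, hef, -⟩ := exists_openPartialHomeomorph (p := p) (h.contDiff_u.prodMk h.contDiff_v)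
    (by
      rw [hd.fderiv, injective_iff_map_eq_zero]
      intro X hX
      obtain ⟨a, b, rfl⟩ := hspan p X
      simp [h.u_L, h.u_N, h.v_L, h.v_N] at hX
      simp [hX])
  exact ⟨e, he, fun x _ => by rw [hef]⟩

theorem coords_curve_L (h : IsFrameCoords L N u v) {c : ℝ → Plane}
    (hc : ∀ t, HasDerivAt c (L (c t)) t) (t : ℝ) : u (c t) = u (c 0) + t ∧ v (c t) = v (c 0) := by
  have h1 := apply_integralCurve (h.contDiff_u.differentiable (by simp)) h.u_L hc t
  have h2 := apply_integralCurve (h.contDiff_v.differentiable (by simp)) h.v_L hc t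
  simpa using And.intro h1 h2

theorem coords_curve_N (h : IsFrameCoords L N u v) {c : ℝ → Plane}
    (hc : ∀ t, HasDerivAt c (N (c t)) t) (t : ℝ) : u (c t) = u (c 0) ∧ v (c t) = v (c 0) + t :=
  (h.symm.coords_curve_L hc t).symm

/-- Flowing along `L` and then along `N` gives a section of (u, v). Once the section is known to be
continuous, uniqueness of lifts on the connected plane makes it a two-sided inverse. -/
theorem bijective (h : IsFrameCoords L N u v)
    (hspan : ∀ p X : Plane, ∃ a b : ℝ, X = a • L p + b • N p) :
    Function.Bijective fun p => (u p, v p) := by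
  have hloc := h.isLocalHomeomorph hspan
  have hsep : IsSeparatedMap fun p => (u p, v p) := T2Space.isSeparatedMap _
  obtain ⟨a, ha0, ha⟩ := h.exists_curve_L 0
  choose b hb0 hb using h.exists_curve_N
  have hac : Continuous a := continuous_iff_continuousAt.2 fun t => (ha t).continuousAt
  have hbc : ∀ p, Continuous (b p) := fun p =>
    continuous_iff_continuousAt.2 fun t => (hb p t).continuousAt
  -- Continuity of the section without continuous dependence of flows on initial data: `g` lifts a
  -- continuous homotopy through a local homeomorphism, starts from a continuous map and is
  -- continuous in the homotopy parameter.
  let g : unitInterval × (ℝ × ℝ) → Plane := fun x => b (a x.2.1) (x.1 * x.2.2)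
  have hg : Continuous g := by
    refine hloc.continuous_lift hsep
      ⟨fun x : unitInterval × (ℝ × ℝ) => (u 0 + x.2.1, v 0 + x.1 * x.2.2), by fun_prop⟩
      (funext fun x => ?_) ?_ ?_
    · have h1 := h.coords_curve_N (hb (a x.2.1)) (x.1 * x.2.2)
      have h2 := h.coords_curve_L ha x.2.1
      rw [hb0] at h1
      rw [ha0] at h2
      simp [g, h1, h2]
    · simp only [g, Set.Icc.coe_zero, zero_mul, hb0]
      fun_prop
    · intro x
      exact (hbc (a x.1)).comp (continuous_subtype_val.mul (continuous_const (y := x.2)))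
  let Ψ : ℝ × ℝ → Plane := fun x => b (a (x.1 - u 0)) (x.2 - v 0)
  have hΨ : Continuous Ψ := by
    have : Ψ = fun x : ℝ × ℝ => g (1, (x.1 - u 0, x.2 - v 0)) := by ext1 x; simp [g, Ψ]
    rw [this]
    exact hg.comp (by fun_prop)
  have hsec : ∀ x, (u (Ψ x), v (Ψ x)) = x := fun x => by
    have h1 := h.coords_curve_N (hb (a (x.1 - u 0))) (x.2 - v 0)
    have h2 := h.coords_curve_L ha (x.1 - u 0)
    rw [hb0] at h1
    rw [ha0] at h2
    simp [Ψ, h1, h2]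
  refine ⟨?_, fun x => ⟨Ψ x, hsec x⟩⟩
  have hinv : (fun p => Ψ (u p, v p)) = id := by
    have huv : Continuous fun p => (u p, v p) :=
      h.contDiff_u.continuous.prodMk h.contDiff_v.continuous
    refine hsep.eq_of_comp_eq hloc.isLocallyInjective (hΨ.comp huv) continuous_id
      (funext fun p => hsec _) 0 ?_
    simp [Ψ, ha0, hb0]
  exact Function.LeftInverse.injective (g := Ψ) fun p => congrFun hinv p

end IsFrameCoords

/-- The spatial part is a Euclidean unit vector, and the norm is the sup norm. -/
theorem IsNullFrame.norm_le_one {φ : Plane → MinkowskiSpace} {L N : Plane → Plane}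
    {l m : Plane → MinkowskiSpace} (h : IsNullFrame φ L N l m) (p : Plane) : ‖l p‖ ≤ 1 := by
  have h0 := h.null_l p
  simp only [minkowski, h.l_zero p] at h0
  rw [pi_norm_le_iff_of_nonneg zero_le_one]
  intro i
  rw [Real.norm_eq_abs, abs_le_one_iff_mul_self_le_one]
  fin_cases i
  · simp [h.l_zero p]
  · simp only [Fin.mk_one]; nlinarith [mul_self_nonneg (l p 2)]
  · simp only [Fin.reduceFinMk]; nlinarith [mul_self_nonneg (l p 1)]

/-- Since x⁰ grows at unit rate along both `L` and `N`, the function x⁰ - u can serve as `v`. -/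
theorem IsNullFrame.exists_isFrameCoords {φ : Plane → MinkowskiSpace} {L N : Plane → Plane}
    {l m : Plane → MinkowskiSpace} (h : IsNullFrame φ L N l m) (hφ : IsSmoothImmersion φ)
    (hproper : IsProperMap φ) (ht : IsTimelike φ) (hH : ∀ p, meanCurvature φ p = 0) :
    ∃ u v, IsFrameCoords L N u v ∧ ∀ p, u p + v p = φ p 0 := by
  obtain ⟨u, hu, huLN⟩ := h.exists_null_coordinate hφ ht hH
  have hφ0 : ContDiff ℝ ∞ fun p => φ p 0 := contDiff_pi.1 hφ.1 0
  have hd : ∀ p, HasFDerivAt (fun p => φ p 0 - u p)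
      ((ContinuousLinearMap.proj 0).comp (fderiv ℝ φ p) - fderiv ℝ u p) p := fun p =>
    (hasFDerivAt_pi'.1 (hφ.1.differentiable (by simp) p).hasFDerivAt 0).sub
      (hu.differentiable (by simp) p).hasFDerivAt
  refine ⟨u, fun p => φ p 0 - u p, ⟨hu, hφ0.sub hu, fun p => (huLN p).1, fun p => (huLN p).2,
    fun p => ?_, fun p => ?_, ?_, ?_⟩, fun p => by ring⟩
  · rw [(hd p).fderiv]
    simp [h.fderiv_L, h.l_zero, huLN]
  · rw [(hd p).fderiv]
    simp [h.fderiv_N, h.m_zero, huLN]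
  · exact exists_integralCurve hφ.1 hproper h.contDiff_L fun x => by
      rw [h.fderiv_L]; exact h.norm_le_one x
  · exact exists_integralCurve hφ.1 hproper h.contDiff_N fun x => by
      rw [h.fderiv_N]; exact h.symm.norm_le_one x

/-! ### Separating arcs on the circle of null directions -/

/-- Future null vectors with time component `1` are determined by their stereographic projection
from one of them, `y`. -/
theorem eq_of_stereographic_eq {v w y : MinkowskiSpace} (hv : v 0 = 1) (hw : w 0 = 1)
    (hy : y 0 = 1) (hvv : minkowski v v = 0) (hww : minkowski w w = 0) (hyy : minkowski y y = 0)
    (hvy : v ≠ y) (hwy : w ≠ y)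
    (h : (v 1 * y 2 - v 2 * y 1) / -minkowski v y = (w 1 * y 2 - w 2 * y 1) / -minkowski w y) :
    v = w := by
  have hA := minkowski_null_neg hv hy hvv hyy hvy
  have hB := minkowski_null_neg hw hy hww hyy hwy
  rw [div_eq_div_iff (by linarith) (by linarith)] at h
  simp only [minkowski, hv, hw, hy] at hvv hww hyy hA hB h
  set A := -(1 * 1) + v 1 * y 1 + v 2 * y 2 with hA'
  set B := -(1 * 1) + w 1 * y 1 + w 2 * y 2 with hB'
  set s := v 1 * y 2 - v 2 * y 1 with hs
  set r := w 1 * y 2 - w 2 * y 1 with hr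
  -- The projection is -s/A, and its square -(2 + A)/A determines A.
  have e1 : s ^ 2 = -A * (2 + A) := by
    rw [hs, hA']; linear_combination (y 1 ^ 2 + y 2 ^ 2) * hvv + hyy
  have e2 : r ^ 2 = -B * (2 + B) := by
    rw [hr, hB']; linear_combination (y 1 ^ 2 + y 2 ^ 2) * hww + hyy
  have hAB : A = B := by
    have : A * B * (2 * (A - B)) = 0 := by
      linear_combination (s * B + r * A) * (-h) - B ^ 2 * e1 + A ^ 2 * e2
    have := (mul_eq_zero.1 this).resolve_left (mul_ne_zero hA.ne hB.ne)
    linarith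
  have hsr : s = r := by
    rw [hAB] at h
    exact mul_right_cancel₀ (neg_ne_zero.2 hB.ne) h
  -- The spatial part of y is a unit vector, so it and its rotation form an orthonormal basis; A + 1
  -- and s are the components of v in it, up to sign.
  ext i
  fin_cases i
  · simp [hv, hw]
  · simp only [Fin.mk_one]
    rw [hA', hB'] at hAB
    rw [hs, hr] at hsr
    linear_combination y 1 * hAB + y 2 * hsr - (v 1 - w 1) * hyy
  · simp only [Fin.reduceFinMk]
    rw [hA', hB'] at hAB
    rw [hs, hr] at hsr
    linear_combination y 2 * hAB - y 1 * hsr - (v 2 - w 2) * hyy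

/-- Two curves of future null directions without common value can be separated, over compact
intervals, by a plane through the origin. -/
theorem exists_separating_functional {x y : ℝ → MinkowskiSpace} (hxc : Continuous x)
    (hyc : Continuous y) (hx0 : ∀ s, x s 0 = 1) (hy0 : ∀ s, y s 0 = 1)
    (hxx : ∀ s, minkowski (x s) (x s) = 0) (hyy : ∀ s, minkowski (y s) (y s) = 0)
    (hne : ∀ s r, x s ≠ y r) {R : ℝ} (hR : 0 ≤ R) :
    ∃ a b c : ℝ, (∀ s ∈ Set.Icc (-R) R, 0 < c + a * x s 1 + b * x s 2) ∧
      ∀ s ∈ Set.Icc (-R) R, c + a * y s 1 + b * y s 2 < 0 := by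
  -- The pole lies on the second curve, so the first avoids it and its projection is continuous,
  -- with image [α, β] over the interval.
  set z := y 0 with hz
  have hz0 : z 0 = 1 := hy0 0
  have hzz : minkowski z z = 0 := hyy 0
  let τ (v : MinkowskiSpace) : ℝ := (v 1 * z 2 - v 2 * z 1) / -minkowski v z
  have hneg : ∀ {v : MinkowskiSpace}, v 0 = 1 → minkowski v v = 0 → v ≠ z → minkowski v z < 0 :=
    fun h0 hn hne => minkowski_null_neg h0 hz0 hn hzz hne
  have hτc : Continuous fun s => τ (x s) := by
    refine Continuous.div (by fun_prop) ?_ fun s => ?_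
    · unfold minkowski; fun_prop
    · exact neg_ne_zero.2 (hneg (hx0 s) (hxx s) (hne s 0)).ne
  have himg := hτc.continuousOn.image_Icc (show -R ≤ R by linarith)
  set α := sInf ((fun s => τ (x s)) '' Set.Icc (-R) R)
  set β := sSup ((fun s => τ (x s)) '' Set.Icc (-R) R)
  -- As τ² = (1 + v·z)/(1 - v·z) for the spatial parts, (1 - v·z)(τ - α)(τ - β) is affine in v. Its
  -- sign tells whether τ lies in [α, β], and at the pole its value is 2.
  let lam (v : MinkowskiSpace) : ℝ := (1 + v 1 * z 1 + v 2 * z 2)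
    - (α + β) * (v 1 * z 2 - v 2 * z 1) + α * β * (1 - v 1 * z 1 - v 2 * z 2)
  have hlam : ∀ {v : MinkowskiSpace}, v 0 = 1 → minkowski v v = 0 → v ≠ z →
      lam v = -minkowski v z * ((τ v - α) * (τ v - β)) := by
    intro v h0 hn hne
    have hA := hneg h0 hn hne
    have hτ : τ v * -minkowski v z = v 1 * z 2 - v 2 * z 1 :=
      div_mul_cancel₀ _ (neg_ne_zero.2 hA.ne)
    refine mul_left_cancel₀ hA.ne ?_
    simp only [lam]
    set t := τ v
    simp only [minkowski, h0, hz0] at hn hzz hτ ⊢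
    set A := -(1 * 1) + v 1 * z 1 + v 2 * z 2 with hA'
    have e1 : (v 1 * z 2 - v 2 * z 1) ^ 2 = -A * (2 + A) := by
      rw [hA']; linear_combination (z 1 ^ 2 + z 2 ^ 2) * hn + hzz
    rw [← hτ] at e1 ⊢
    rw [show 1 + v 1 * z 1 + v 2 * z 2 = 2 + A by rw [hA']; ring,
      show 1 - v 1 * z 1 - v 2 * z 2 = -A by rw [hA']; ring]
    linear_combination e1
  have hlx : ∀ s ∈ Set.Icc (-R) R, lam (x s) ≤ 0 := by
    intro s hs
    rw [hlam (hx0 s) (hxx s) (hne s 0)]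
    have h1 : τ (x s) ∈ Set.Icc α β := himg ▸ Set.mem_image_of_mem _ hs
    have h2 := hneg (hx0 s) (hxx s) (hne s 0)
    exact mul_nonpos_of_nonneg_of_nonpos (by linarith)
      (mul_nonpos_of_nonneg_of_nonpos (by linarith [h1.1]) (by linarith [h1.2]))
  have hly : ∀ s, 0 < lam (y s) := by
    intro s
    by_cases hs : y s = z
    · simp only [minkowski, hz0] at hzz
      simp only [lam, hs]
      rw [show 1 - z 1 * z 1 - z 2 * z 2 = 0 by linarith]
      linarith
    · rw [hlam (hy0 s) (hyy s) hs]
      have h2 := hneg (hy0 s) (hyy s) hs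
      refine mul_pos (by linarith) ?_
      have h3 : τ (y s) ∉ Set.Icc α β := by
        rw [← himg]
        rintro ⟨r, -, hr⟩
        exact hne r s (eq_of_stereographic_eq (hx0 r) (hy0 s) hz0 (hxx r) (hyy s) hzz (hne r 0) hs
          hr)
      have h4 : α ≤ β := by
        have : (Set.Icc α β).Nonempty := himg ▸ ⟨_, Set.mem_image_of_mem _ ⟨neg_nonpos.2 hR, hR⟩⟩
        exact Set.nonempty_Icc.1 this
      rw [Set.mem_Icc, not_and_or, not_le, not_le] at h3
      rcases h3 with h3 | h3
      · exact mul_pos_of_neg_of_neg (by linarith) (by linarith)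
      · exact mul_pos (by linarith) (by linarith)
  have hlc : Continuous fun s => lam (y s) := by
    simp only [lam]; fun_prop
  obtain ⟨r, -, hr⟩ := (isCompact_Icc (a := -R) (b := R)).exists_isMinOn
    ⟨0, neg_nonpos.2 hR, hR⟩ hlc.continuousOn
  have hpos := hly r
  -- The functional is lam(y r)/2 - lam; shifting by half the minimum over the second arc makes both
  -- inequalities strict.
  refine ⟨-((1 - α * β) * z 1 - (α + β) * z 2), -((1 - α * β) * z 2 + (α + β) * z 1),
    lam (y r) / 2 - (1 + α * β), fun s hs => ?_, fun s hs => ?_⟩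
  · have h1 : lam (x s) ≤ 0 := hlx s hs
    have h2 : lam (x s) = 1 + α * β + ((1 - α * β) * z 1 - (α + β) * z 2) * x s 1
      + ((1 - α * β) * z 2 + (α + β) * z 1) * x s 2 := by simp only [lam]; ring
    linarith
  · have h1 : lam (y r) ≤ lam (y s) := hr hs
    have h2 : lam (y s) = 1 + α * β + ((1 - α * β) * z 1 - (α + β) * z 2) * y s 1
      + ((1 - α * β) * z 2 + (α + β) * z 1) * y s 2 := by simp only [lam]; ring
    linarith

/-! ### Separation of the null directions of the surface -/

section

variable {φ : Plane → MinkowskiSpace} {L N : Plane → Plane} {l m : Plane → MinkowskiSpace}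
  {u v : Plane → ℝ}

/-- The flow of `N` fixes `u` and shifts `v`, so by injectivity of (u, v) it carries p to q. -/
theorem IsNullFrame.l_eq_of_u_eq (h : IsNullFrame φ L N l m) (hc : IsFrameCoords L N u v)
    (hconst : ∀ p, fderiv ℝ l p (N p) = 0) {p q : Plane} (hpq : u p = u q) : l p = l q := by
  obtain ⟨c, hc0, hcN⟩ := hc.exists_curve_N p
  have hq : c (v q - v p) = q := by
    refine (hc.bijective h.exists_coords).1 ?_
    have := hc.coords_curve_N hcN (v q - v p)
    rw [hc0] at this
    simp [this, hpq]
  have hd : ∀ t, HasDerivAt (l ∘ c) 0 t := fun t => by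
    have := (h.contDiff_l.differentiable (by simp) (c t)).hasFDerivAt.comp_hasDerivAt t (hcN t)
    rwa [hconst] at this
  have := is_const_of_deriv_eq_zero (fun t => (hd t).differentiableAt) (fun t => (hd t).deriv) 0
    (v q - v p)
  simpa [hc0, hq] using this

theorem IsNullFrame.exists_separating_functional (h : IsNullFrame φ L N l m)
    (hc : IsFrameCoords L N u v) (hl : ∀ p, fderiv ℝ l p (N p) = 0)
    (hm : ∀ p, fderiv ℝ m p (L p) = 0) {R : ℝ} (hR : 0 ≤ R) :
    ∃ a b c : ℝ, (∀ p, |u p| ≤ R → 0 < c + a * l p 1 + b * l p 2) ∧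
      ∀ p, |v p| ≤ R → c + a * m p 1 + b * m p 2 < 0 := by
  have hbij := hc.bijective h.exists_coords
  have hl' := fun p q => h.l_eq_of_u_eq hc hl (p := p) (q := q)
  have hm' := fun p q => h.symm.l_eq_of_u_eq hc.symm hm (p := p) (q := q)
  obtain ⟨o, ho⟩ := hbij.2 (0, 0)
  simp only [Prod.mk.injEq] at ho
  obtain ⟨c₁, hc₁0, hc₁⟩ := hc.exists_curve_L o
  obtain ⟨c₂, hc₂0, hc₂⟩ := hc.exists_curve_N o
  have k₁ : ∀ t, u (c₁ t) = t := fun t => by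
    rw [(hc.coords_curve_L hc₁ t).1, hc₁0, ho.1, zero_add]
  have k₂ : ∀ t, v (c₂ t) = t := fun t => by
    rw [(hc.coords_curve_N hc₂ t).2, hc₂0, ho.2, zero_add]
  have cc₁ : Continuous c₁ := continuous_iff_continuousAt.2 fun t => (hc₁ t).continuousAt
  have cc₂ : Continuous c₂ := continuous_iff_continuousAt.2 fun t => (hc₂ t).continuousAt
  obtain ⟨a, b, c, h₁, h₂⟩ := _root_.exists_separating_functional
    (h.contDiff_l.continuous.comp cc₁) (h.contDiff_m.continuous.comp cc₂)
    (fun s => h.l_zero _) (fun s => h.m_zero _) (fun s => h.null_l _) (fun s => h.null_m _)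
    -- A common value would give `l = m` at the point with coordinates (s, r).
    (fun s r hsr => by
      obtain ⟨q, hq⟩ := hbij.2 (s, r)
      simp only [Prod.mk.injEq] at hq
      refine h.l_ne_m q ?_
      rw [hl' q (c₁ s) (by rw [hq.1, k₁]), hm' q (c₂ r) (by rw [hq.2, k₂])]
      exact hsr) hR
  refine ⟨a, b, c, fun p hp => ?_, fun p hp => ?_⟩
  · rw [hl' p (c₁ (u p)) (k₁ _).symm]
    exact h₁ _ (abs_le.1 hp)
  · rw [hm' p (c₂ (v p)) (k₂ _).symm]
    exact h₂ _ (abs_le.1 hp)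

end

/-! ### Smooth inverses and injectivity on squares -/

/-- A smooth map which is injective with injective differential on an open set is an open
embedding of that set with smooth inverse. -/
theorem exists_contDiffOn_inverse {Q : Plane → ℝ × ℝ} (hQ : ContDiff ℝ ∞ Q) {V : Set Plane}
    (hV : IsOpen V) (hinj : Set.InjOn Q V)
    (hd : ∀ p ∈ V, Function.Injective (fderiv ℝ Q p)) :
    IsOpen (Q '' V) ∧ ∃ g : ℝ × ℝ → Plane, ContDiffOn ℝ ∞ g (Q '' V) ∧ ∀ p ∈ V, g (Q p) = p := by
  have hg : ∀ p ∈ V, Function.invFunOn Q V (Q p) = p := fun p hp => hinj.leftInvOn_invFunOn hp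
  -- Local inverses take values in V, so injectivity identifies them with `Function.invFunOn`.
  have key : ∀ p ∈ V, ∃ g : ℝ × ℝ → Plane, ContDiffAt ℝ ∞ g (Q p) ∧
      ∀ᶠ y in nhds (Q p), g y ∈ V ∧ Q (g y) = y := by
    intro p hp
    obtain ⟨e, he, rfl, hes⟩ := exists_openPartialHomeomorph hQ (hd p hp)
    refine ⟨e.symm, hes, ?_⟩
    have h1 : V ∈ nhds (e.symm (e p)) := by rw [e.left_inv he]; exact hV.mem_nhds hp
    filter_upwards [hes.continuousAt.preimage_mem_nhds h1,
      e.eventually_right_inverse (e.map_source he)] with y h2 h3 using ⟨h2, h3⟩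
  refine ⟨isOpen_iff_mem_nhds.2 ?_, Function.invFunOn Q V, ?_, hg⟩
  · rintro _ ⟨p, hp, rfl⟩
    obtain ⟨g, -, h⟩ := key p hp
    filter_upwards [h] with y hy using ⟨g y, hy⟩
  · rintro _ ⟨p, hp, rfl⟩
    obtain ⟨g, hgs, h⟩ := key p hp
    refine (hgs.congr_of_eventuallyEq ?_).contDiffWithinAt
    filter_upwards [h] with y hy
    rw [← hg _ hy.1, hy.2]

theorem strictMonoOn_comp_curve {E : Type*} [NormedAddCommGroup E] [NormedSpace ℝ E] {f : E → ℝ}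
    (hf : Differentiable ℝ f) {X : E → E} {c : ℝ → E} (hc : ∀ t, HasDerivAt c (X (c t)) t) {d : ℝ}
    (hpos : ∀ t ∈ Set.Ioo 0 d, 0 < fderiv ℝ f (c t) (X (c t))) :
    StrictMonoOn (fun t => f (c t)) (Set.Icc 0 d) := by
  have h : ∀ t, HasDerivAt (fun t => f (c t)) (fderiv ℝ f (c t) (X (c t))) t := fun t =>
    (hf (c t)).hasFDerivAt.comp_hasDerivAt t (hc t)
  refine strictMonoOn_of_deriv_pos (convex_Icc 0 d)
    (fun t _ => (h t).continuousAt.continuousWithinAt) fun t ht => ?_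
  rw [interior_Icc] at ht
  rw [(h t).deriv]
  exact hpos t ht

/-- A function which increases along `L` and decreases along `N` separates points with the same
value of `u + v`. -/
theorem IsFrameCoords.eq_of_add_eq {L N : Plane → Plane} {u v : Plane → ℝ}
    (hc : IsFrameCoords L N u v) (hspan : ∀ p X : Plane, ∃ a b : ℝ, X = a • L p + b • N p)
    {f : Plane → ℝ} (hf : Differentiable ℝ f) {R : ℝ}
    (hL : ∀ p, |u p| ≤ R → 0 < fderiv ℝ f p (L p))
    (hN : ∀ p, |v p| ≤ R → fderiv ℝ f p (N p) < 0) {p q : Plane}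
    (hp : |u p| ≤ R ∧ |v p| ≤ R) (hq : |u q| ≤ R ∧ |v q| ≤ R) (hadd : u p + v p = u q + v q)
    (hfpq : f p = f q) : p = q := by
  wlog hle : u p ≤ u q generalizing p q
  · exact (this hq hp hadd.symm hfpq.symm (le_of_not_ge hle)).symm
  have hbij := hc.bijective hspan
  rcases hle.eq_or_lt with heq | hlt
  · exact hbij.1 (Prod.ext heq (by simp only; linarith))
  exfalso
  obtain ⟨c₁, hc₁0, hc₁⟩ := hc.exists_curve_L p
  obtain ⟨c₂, hc₂0, hc₂⟩ := hc.exists_curve_N q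
  have k₁ := hc.coords_curve_L hc₁
  have k₂ := hc.coords_curve_N hc₂
  rw [hc₁0] at k₁
  rw [hc₂0] at k₂
  set d := u q - u p with hd
  have hdpos : 0 < d := sub_pos.2 hlt
  -- Both curves end at the point with coordinates (u q, v p) and stay in the strips where f is
  -- monotone, so f p < f (c₁ d) < f q.
  have hmeet : c₁ d = c₂ d := hbij.1 (by
    simp only [k₁, k₂, Prod.mk.injEq]
    constructor <;> linarith)
  rw [abs_le, abs_le] at hp hq
  have h₁ := strictMonoOn_comp_curve hf hc₁ (d := d) fun t ht => hL _ (by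
    rw [(k₁ t).1, abs_le]
    constructor <;> linarith [ht.1, ht.2])
  have h₂ := strictMonoOn_comp_curve hf.neg hc₂ (d := d) fun t ht => by
    have := hN (c₂ t) (by
      rw [(k₂ t).2, abs_le]
      constructor <;> linarith [ht.1, ht.2])
    rw [fderiv_neg]
    simpa using this
  have e₁ := h₁ (Set.left_mem_Icc.2 hdpos.le) (Set.right_mem_Icc.2 hdpos.le) hdpos
  have e₂ := h₂ (Set.left_mem_Icc.2 hdpos.le) (Set.right_mem_Icc.2 hdpos.le) hdpos
  simp only [Pi.neg_apply, hc₁0, hc₂0, hmeet] at e₁ e₂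
  linarith

/-! ### Graphs over vertical planes -/

/-- The plane spanned by the time axis and the spatial direction `(a, b)`. -/
def verticalPlane (a b : ℝ) : Submodule ℝ MinkowskiSpace :=
  LinearMap.ker (a • LinearMap.proj 2 - b • LinearMap.proj 1 : MinkowskiSpace →ₗ[ℝ] ℝ)

theorem mem_verticalPlane {a b : ℝ} {x : MinkowskiSpace} :
    x ∈ verticalPlane a b ↔ a * x 2 - b * x 1 = 0 := by
  simp [verticalPlane]

theorem isTimelikePlane_verticalPlane {a b : ℝ} (hab : a ^ 2 + b ^ 2 ≠ 0) :
    IsTimelikePlane (verticalPlane a b) := by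
  refine ⟨?_, Pi.single 0 1, by simp [mem_verticalPlane], by simp [minkowski]⟩
  have hne : (a • LinearMap.proj 2 - b • LinearMap.proj 1 : MinkowskiSpace →ₗ[ℝ] ℝ) ≠ 0 := by
    intro h
    have := LinearMap.congr_fun h ![0, -b, a]
    simp at this
    exact hab (by linear_combination this)
  have := Module.Dual.finrank_ker_add_one_of_ne_zero hne
  simp at this
  exact this

/-- The coordinates `x 0` and `a x 1 + b x 2`, which restrict to coordinates on
`verticalPlane a b`. -/
def verticalCoords (a b : ℝ) : MinkowskiSpace →L[ℝ] ℝ × ℝ :=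
  (ContinuousLinearMap.proj 0).prod
    (a • ContinuousLinearMap.proj 1 + b • ContinuousLinearMap.proj 2)

theorem verticalCoords_apply (a b : ℝ) (x : MinkowskiSpace) :
    verticalCoords a b x = (x 0, a * x 1 + b * x 2) := rfl

/-- If `φ` composed with the projection to a vertical plane is injective with injective differential
on an open set `V`, then the image of any subset of `V` is a smooth graph. -/
theorem isSmoothGraphOver_verticalPlane {φ : Plane → MinkowskiSpace} (hφ : ContDiff ℝ ∞ φ)
    {a b : ℝ} (hab : a ^ 2 + b ^ 2 ≠ 0) {V : Set Plane} (hV : IsOpen V)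
    (hinj : Set.InjOn (fun p => verticalCoords a b (φ p)) V)
    (hd : ∀ p ∈ V, Function.Injective fun X => verticalCoords a b (fderiv ℝ φ p X))
    {K : Set MinkowskiSpace} (hK : K ⊆ φ '' V) :
    IsSmoothGraphOver (verticalPlane a b) K := by
  set J := verticalCoords a b with hJ
  obtain ⟨hopen, g, hg, hgV⟩ := exists_contDiffOn_inverse (J.contDiff.comp hφ) hV hinj fun p hp => by
    rw [(J.hasFDerivAt.comp p (hφ.differentiable (by simp) p).hasFDerivAt).fderiv]
    exact hd p hp
  let j : verticalPlane a b →L[ℝ] ℝ × ℝ := J.comp (verticalPlane a b).subtypeL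
  -- A spanning vector of the η-orthogonal complement of the plane, killed by `J`; `h` reads off the
  -- component along it.
  let k : MinkowskiSpace := ![0, -b, a]
  let h : MinkowskiSpace → ℝ := fun x => (a * x 2 - b * x 1) / (a ^ 2 + b ^ 2)
  have hh : ContDiff ℝ ∞ h := by simp only [h]; fun_prop
  let f : verticalPlane a b → MinkowskiSpace := fun p => h (φ (g (j p))) • k
  let U : Set (verticalPlane a b) := j ⁻¹' ((J ∘ φ) '' V)
  refine ⟨{p | p ∈ U ∧ (p : MinkowskiSpace) + f p ∈ K}, U, f, hopen.preimage j.continuous,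
    fun p hp => hp.1, ?_, ?_, ?_⟩
  · have h1 : ContDiffOn ℝ ∞ (fun p => g (j p)) U :=
      hg.comp j.contDiff.contDiffOn (Set.mapsTo_preimage _ _)
    exact ((hh.comp hφ).comp_contDiffOn h1).smul contDiffOn_const
  · intro p _ q
    have hq := mem_verticalPlane.1 q.2
    simp only [f, k, minkowski, Pi.smul_apply, Matrix.cons_val, smul_eq_mul]
    linear_combination h (φ (g (j p))) * hq
  · ext y
    constructor
    · intro hy
      obtain ⟨x, hx, rfl⟩ := hK hy
      have hkey : a * (φ x - h (φ x) • k) 2 - b * (φ x - h (φ x) • k) 1 = 0 := by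
        simp only [h, k, Pi.sub_apply, Pi.smul_apply, Matrix.cons_val, smul_eq_mul]
        field_simp
        ring
      let p : verticalPlane a b := ⟨φ x - h (φ x) • k, mem_verticalPlane.2 hkey⟩
      have hjp : j p = J (φ x) := by
        change J (φ x - h (φ x) • k) = J (φ x)
        rw [map_sub, map_smul, sub_eq_self, hJ, verticalCoords_apply]
        simp only [k, Matrix.cons_val]
        simp
        right; ring
      have hp : (p : MinkowskiSpace) + f p = φ x := by
        have : g (j p) = x := by rw [hjp]; exact hgV x hx
        simp only [f, this, p]
        abel
      exact ⟨p, ⟨⟨x, hx, hjp.symm⟩, by rwa [hp]⟩, hp⟩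
    · rintro ⟨p, hp, rfl⟩
      exact hp.2

/-! ### Embedding and graphs -/

theorem theorem1 (φ : Plane → MinkowskiSpace)
    (himm : IsSmoothImmersion φ)
    (hproper : IsProperMap φ)
    (htimelike : IsTimelike φ)
    (hH : ∀ p, meanCurvature φ p = 0) :
    IsSmoothEmbedding φ ∧
    ∀ K : Set MinkowskiSpace, K ⊆ Set.range φ → IsCompact K →
      ∃ P : Submodule ℝ MinkowskiSpace, IsTimelikePlane P ∧ IsSmoothGraphOver P K := by
  obtain ⟨L, N, l, m, h⟩ := exists_isNullFrame himm.1 htimelike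
  obtain ⟨u, v, hc, huv⟩ := h.exists_isFrameCoords himm hproper htimelike hH
  have hdφ : ∀ p, HasFDerivAt φ (fderiv ℝ φ p) p := fun p =>
    (himm.1.differentiable (by simp) p).hasFDerivAt
  have key : ∀ R, 0 ≤ R → ∃ a b : ℝ, a ^ 2 + b ^ 2 ≠ 0 ∧
      Set.InjOn (fun p => verticalCoords a b (φ p)) {p | |u p| < R ∧ |v p| < R} ∧
      ∀ p ∈ {p | |u p| < R ∧ |v p| < R},
        Function.Injective fun X => verticalCoords a b (fderiv ℝ φ p X) := by
    intro R hR
    obtain ⟨a, b, c, hl, hm⟩ := h.exists_separating_functional hc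
      (fun p => h.fderiv_l_N himm.1 (htimelike p).ne (hH p))
      (fun p => h.symm.fderiv_l_N himm.1 (htimelike p).ne (hH p)) hR
    let Λ : MinkowskiSpace →L[ℝ] ℝ := c • ContinuousLinearMap.proj 0
      + a • ContinuousLinearMap.proj 1 + b • ContinuousLinearMap.proj 2
    have hΛ : ∀ x, Λ x = c * x 0 + a * x 1 + b * x 2 := fun x => by simp [Λ]
    have hΛ' : ∀ {x y}, verticalCoords a b x = verticalCoords a b y → Λ x = Λ y := by
      intro x y hxy
      rw [verticalCoords_apply, verticalCoords_apply, Prod.mk.injEq] at hxy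
      rw [hΛ, hΛ]
      linear_combination c * hxy.1 + hxy.2
    have hd : ∀ p, HasFDerivAt (fun p => Λ (φ p)) (Λ.comp (fderiv ℝ φ p)) p := fun p =>
      Λ.hasFDerivAt.comp p (hdφ p)
    have hL : ∀ p, |u p| ≤ R → 0 < Λ (l p) := fun p hp => by
      rw [hΛ, h.l_zero]; simpa using hl p hp
    have hN : ∀ p, |v p| ≤ R → Λ (m p) < 0 := fun p hp => by
      rw [hΛ, h.m_zero]; simpa using hm p hp
    refine ⟨a, b, fun hab => ?_, fun p hp q hq hpq => ?_, fun p hp => ?_⟩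
    -- If a = b = 0, the constant c would be both positive and negative.
    · have ha : a = 0 := by nlinarith [sq_nonneg a, sq_nonneg b]
      have hb : b = 0 := by nlinarith [sq_nonneg a, sq_nonneg b]
      obtain ⟨o, ho⟩ := (hc.bijective h.exists_coords).2 (0, 0)
      simp only [Prod.mk.injEq] at ho
      have h1 := hl o (by simpa [ho] using hR)
      have h2 := hm o (by simpa [ho] using hR)
      simp only [ha, hb] at h1 h2
      linarith
    · refine hc.eq_of_add_eq h.exists_coords (fun p => (hd p).differentiableAt) (R := R)
        (fun p hp => ?_) (fun p hp => ?_) ⟨hp.1.le, hp.2.le⟩ ⟨hq.1.le, hq.2.le⟩ ?_ (hΛ' hpq)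
      · rw [(hd p).fderiv]
        simpa [h.fderiv_L] using hL p hp
      · rw [(hd p).fderiv]
        simpa [h.fderiv_N] using hN p hp
      · rw [huv, huv]
        exact congrArg Prod.fst hpq
    -- The infinitesimal version: x + y = 0 and x (Λ l - Λ m) = 0, with Λ l > 0 > Λ m.
    · change Function.Injective ((verticalCoords a b).comp (fderiv ℝ φ p))
      rw [injective_iff_map_eq_zero]
      intro X hX
      obtain ⟨x, y, rfl⟩ := h.exists_coords p X
      have e : fderiv ℝ φ p (x • L p + y • N p) = x • l p + y • m p := by
        rw [map_add, map_smul, map_smul, h.fderiv_L, h.fderiv_N]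
      rw [ContinuousLinearMap.comp_apply, e] at hX
      have e1 : x + y = 0 := by
        simpa [verticalCoords_apply, h.l_zero, h.m_zero] using congrArg Prod.fst hX
      have e2 : Λ (x • l p + y • m p) = Λ 0 := hΛ' (by rw [hX, map_zero])
      rw [map_add, map_smul, map_smul, map_zero, smul_eq_mul, smul_eq_mul] at e2
      have h1 := hL p hp.1.le
      have h2 := hN p hp.2.le
      have hx : x = 0 := by
        have : x * (Λ (l p) - Λ (m p)) = 0 := by linear_combination e2 - Λ (m p) * e1
        exact (mul_eq_zero.1 this).resolve_right (by linarith)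
      have hy : y = 0 := by linarith
      simp [hx, hy]
  have hu := hc.contDiff_u.continuous
  have hv := hc.contDiff_v.continuous
  have hinj : Function.Injective φ := by
    intro p q hpq
    -- Any square containing both points works; the extra 1 makes the bounds strict.
    let R := |u p| + |v p| + |u q| + |v q| + 1
    have h1 := abs_nonneg (u p)
    have h2 := abs_nonneg (v p)
    have h3 := abs_nonneg (u q)
    have h4 := abs_nonneg (v q)
    obtain ⟨a, b, -, hinj, -⟩ := key R (by positivity)
    exact hinj (by constructor <;> simp only [R] <;> linarith)
      (by constructor <;> simp only [R] <;> linarith) (by simp only [hpq])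
  refine ⟨⟨himm, (Topology.IsClosedEmbedding.of_continuous_injective_isClosedMap hproper.continuous
    hinj hproper.isClosedMap).isEmbedding⟩, fun K hKr hK => ?_⟩
  obtain ⟨C₁, hC₁⟩ := (hproper.isCompact_preimage hK).exists_bound_of_continuousOn hu.continuousOn
  obtain ⟨C₂, hC₂⟩ := (hproper.isCompact_preimage hK).exists_bound_of_continuousOn hv.continuousOn
  obtain ⟨a, b, hab, hinjV, hdV⟩ := key (|C₁| + |C₂| + 1) (by positivity)
  refine ⟨verticalPlane a b, isTimelikePlane_verticalPlane hab,
    isSmoothGraphOver_verticalPlane himm.1 hab ?_ hinjV hdV ?_⟩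
  · exact (isOpen_lt hu.abs continuous_const).inter (isOpen_lt hv.abs continuous_const)
  · intro y hy
    obtain ⟨x, rfl⟩ := hKr hy
    have h1 := hC₁ x hy
    have h2 := hC₂ x hy
    rw [Real.norm_eq_abs] at h1 h2
    refine ⟨x, ⟨?_, ?_⟩, rfl⟩
    · linarith [le_abs_self C₁, abs_nonneg C₂]
    · linarith [le_abs_self C₂, abs_nonneg C₁]
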